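/- Let $N$ be a finite set. Consider real vectors indexed by the non-empty subsets of $N$, with the scalar product $\mathbf e\cdot\mathbf x=\sum_{\emptyset\ne A\subseteq N}\mathbf e(A)\,\mathbf x(A)$. The entropy region $\Gamma^*_N$ is the set of all vectors $\big(\mathbf H(\xi_A)\big)_{\emptyset\ne A\subseteq N}$, where $\xi=(\xi_i)_{i\in N}$ ranges over the jointly distributed families of random variables with finite alphabets, $\xi_A=(\xi_i)_{i\in A}$ is the marginal of $\xi$ on $A$, and $\mathbf H$ is Shannon entropy (in bits). Let $$\mathcal E=\{\mathbf e:\ \mathbf e\cdot\mathbf x\ge 0\ \text{ for all }\mathbf x\in\Gamma^*_N\}$$ be the cone of valid linear entropy inequalities. For $i\in N$ let $\mathbf s_i$ be the coefficient vector of the basic Shannon inequality $\mathbf H(N)\ge\mathbf H(N\setminus\{i\})$, that is, $\mathbf s_i(N)=1$, $\mathbf s_i(N\setminus\{i\})=-1$ (the latter only if $N\ne\{i\}$), and all other coordinates are $0$; and let $\mathbf r_i$ be the vector with $\mathbf r_i(A)=1$ if $i\in A$ and $\mathbf r_i(A)=0$ otherwise. A vector $\mathbf e$ is called balanced if $\mathbf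 e\cdot\mathbf r_i=0$ for all $i\in N$. Then for each $\mathbf e\in\mathcal E$ there are unique real numbers $\mu_i\ge 0$ $(i\in N)$ and a unique balanced vector $\mathbf e^\circ\in\mathcal E$ such that $$\mathbf e=\sum_{i\in N}\mu_i\,\mathbf s_i+\mathbf e^\circ .$$ -/

import Mathlib

namespace EntropyIneq

/-- Real vectors indexed by the non-empty subsets of the finite base set `N`. They serve both as
points of the `(2 ^ |N| - 1)`-dimensional Euclidean space of entropy profiles and as coefficient
vectors of linear inequalities. -/
abbrev SetVec (N : Type*) : Type _ := {A : Finset N // A.Nonempty} → ℝ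

/-- Shannon entropy, in bits, of the probability mass function `q` on a finite alphabet
(`0 * logb 2 0 = 0` holds in Mathlib). -/
noncomputable def shannonEntropy {Y : Type*} [Fintype Y] (q : Y → ℝ) : ℝ :=
  ∑ y, -(q y * Real.logb 2 (q y))

/-- The marginal on the coordinates in `A` of a mass function `p` on a product of alphabets. -/
noncomputable def marginal {N : Type*} [Fintype N] [DecidableEq N] {X : N → Type*}
    [∀ i, Fintype (X i)] [∀ i, DecidableEq (X i)] (p : (∀ i, X i) → ℝ) (A : Finset N) : (∀ i : A, X i) → ℝ :=
  fun y => ∑ x with (fun i : A => x i) = y, p x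

/-- The entropy profile of a mass function `p`: the entropies of its marginals on the
non-empty subsets of the base. -/
noncomputable def entropyProfile {N : Type*} [Fintype N] [DecidableEq N] {X : N → Type*}
    [∀ i, Fintype (X i)] [∀ i, DecidableEq (X i)] (p : (∀ i, X i) → ℝ) : SetVec N :=
  fun A => shannonEntropy (marginal p A.1)

/-- The entropy region: the entropy profiles of all jointly distributed families, with base `N`,
of random variables with finite alphabets. -/
def entropyRegion (N : Type*) [Fintype N] [DecidableEq N] : Set (SetVec N) :=
  {h | ∃ (X : N → Type) (_ : ∀ i, Fintype (X i)) (_ : ∀ i, DecidableEq (X i)),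
    ∃ p ∈ stdSimplex ℝ (∀ i, X i), h = entropyProfile p}

/-- The coefficient vectors `e` of valid entropy inequalities `e ⬝ᵥ x ≥ 0`. -/
def validIneqs (N : Type*) [Fintype N] [DecidableEq N] : Set (SetVec N) :=
  {e | ∀ x ∈ entropyRegion N, 0 ≤ e ⬝ᵥ x}

/-- The coefficient vector of the basic Shannon inequality `H(N) ≥ H(N \ i)`. When `N = {i}`,
the coordinate of `N \ i = ∅` does not exist, in agreement with `H(∅) = 0`. -/
def basicIneq {N : Type*} [Fintype N] [DecidableEq N] (i : N) : SetVec N :=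
  fun A => if A.1 = Finset.univ then 1 else if A.1 = Finset.univ.erase i then -1 else 0

/-- The indicator vector of the relation `i ∈ A`. -/
def indicatorVec {N : Type*} [DecidableEq N] (i : N) : SetVec N :=
  fun A => if i ∈ A.1 then 1 else 0

/-- The inequality with coefficient vector `e` is balanced. -/
def IsBalanced {N : Type*} [Fintype N] [DecidableEq N] (e : SetVec N) : Prop :=
  ∀ i : N, e ⬝ᵥ indicatorVec i = 0

end EntropyIneq

/-!
Pairing a decomposition `e = ∑ i, μ i • s_i + e°` with the vector `r_j` gives `μ j = e ⬝ᵥ r_j`,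
because `s_i ⬝ᵥ r_j` is `1` if `i = j` and `0` otherwise; so the decomposition is unique and its
balanced part is determined. Each `r_j` is an entropy profile
(`indicatorVec_mem_entropyRegion`), hence `μ j ≥ 0`. What has to be proved is that the balanced
part is valid, and for this it suffices to subtract one multiple `(e ⬝ᵥ r_i) • s_i` at a time
(`sub_smul_basicIneq_mem_validIneqs`): for every family of random variables,
`e ⬝ᵥ h ≥ (e ⬝ᵥ r_i) (H(N) - H(N \ i))`, where `h` is the entropy profile.

Take `n` independent copies of the family, and let `V` be a function of the `i`-th variable of this
new family which is almost uniform and almost independent of all the other variables together, and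
whose entropy per copy is close to `H(N) - H(N \ i)`. A valid inequality holds for the family
conditioned on each value of `V`, so it holds for the conditional entropies given `V`
(`sum_mul_condEnt_nonneg`). Conditioning on `V` lowers the entropy of a set `A` by `H(V)` if
`i ∈ A`, as `V` is then a function of the variables in `A`, and changes it by a bounded amount
otherwise. Dividing by `n` and letting `n` tend to infinity gives the claim (`mul_le_sum_mul_ent`).

The function `V` is a random hash (`exists_hash`). If `M` is the number of its values, Jensen's
inequality bounds the expected value of `log M - H(V | rest)` by that of
`log (1 + M p(x_i | x_rest))`. Since `log (1 + t) ≤ t ^ s / s` for `0 < s ≤ 1`, the latter is at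
most `1 / s` times a moment that factors over the independent copies, and a single factor is
controlled by the derivative of the moment at `s = 0`, minus the conditional entropy
(`exists_moment_le`). This gives a bound uniform in `n` without any typical-sequence argument.
-/

namespace EntropyIneq

/-! ### Entropy of a function on a finite probability space -/

/-- The distribution of `X` under the mass function `p`. -/
noncomputable def law {Ω Y : Type*} [Fintype Ω] [DecidableEq Y] (p : Ω → ℝ) (X : Ω → Y) (y : Y) :
    ℝ :=
  ∑ ω with X ω = y, p ω

/-- The entropy of `X` under `p`, in nats. It is written as the expectation of `-log (law p X X)`,
a sum over the sample space, so that entropies of different functions can be compared pointwise. -/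
noncomputable def ent {Ω Y : Type*} [Fintype Ω] [DecidableEq Y] (p : Ω → ℝ) (X : Ω → Y) : ℝ :=
  ∑ ω, -(p ω * Real.log (law p X (X ω)))

section FiniteSpace

variable {Ω Y Z W : Type*} [Fintype Ω] [DecidableEq Y] [DecidableEq Z] [DecidableEq W]
  {p : Ω → ℝ}

lemma law_nonneg (hp : ∀ ω, 0 ≤ p ω) (X : Ω → Y) (y : Y) : 0 ≤ law p X y :=
  Finset.sum_nonneg fun ω _ => hp ω

lemma le_law (hp : ∀ ω, 0 ≤ p ω) (X : Ω → Y) (ω : Ω) : p ω ≤ law p X (X ω) :=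
  Finset.single_le_sum (f := p) (fun ω _ => hp ω) (by simp)

lemma law_pos (hp : ∀ ω, 0 ≤ p ω) (X : Ω → Y) {ω : Ω} (h : p ω ≠ 0) : 0 < law p X (X ω) :=
  ((hp ω).lt_of_ne' h).trans_le (le_law hp X ω)

lemma sum_mul_comp [Fintype Y] (p : Ω → ℝ) (X : Ω → Y) (g : Y → ℝ) :
    ∑ ω, p ω * g (X ω) = ∑ y, law p X y * g y := by
  rw [← Finset.sum_fiberwise Finset.univ X]
  refine Finset.sum_congr rfl fun y _ => ?_
  rw [law, Finset.sum_mul]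
  refine Finset.sum_congr rfl fun ω hω => ?_
  rw [(Finset.mem_filter.1 hω).2]

lemma sum_law [Fintype Y] (p : Ω → ℝ) (X : Ω → Y) : ∑ y, law p X y = ∑ ω, p ω := by
  simpa using (sum_mul_comp p X fun _ => 1).symm

lemma sum_law_prod [Fintype W] (p : Ω → ℝ) (X : Ω → Y) (V : Ω → W) (y : Y) :
    ∑ v, law p (fun ω => (X ω, V ω)) (y, v) = law p X y := by
  simp only [law, Prod.mk.injEq]
  rw [← Finset.sum_fiberwise (Finset.univ.filter fun ω => X ω = y) V]
  simp only [Finset.filter_filter]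

lemma law_eq_of_iff (p : Ω → ℝ) {X : Ω → Y} {V : Ω → W} {ω : Ω}
    (h : ∀ ω', X ω' = X ω ↔ V ω' = V ω) : law p X (X ω) = law p V (V ω) := by
  simp only [law, h]

lemma ent_eq_of_iff (p : Ω → ℝ) {X : Ω → Y} {V : Ω → W}
    (h : ∀ ω ω', X ω' = X ω ↔ V ω' = V ω) : ent p X = ent p V := by
  simp only [ent, fun ω => law_eq_of_iff p (h ω)]

lemma ent_const (hp1 : ∑ ω, p ω = 1) (y : Y) : ent p (fun _ => y) = 0 := by
  simp [ent, law, hp1]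

lemma shannonEntropy_law [Fintype Y] (p : Ω → ℝ) (X : Ω → Y) :
    shannonEntropy (law p X) * Real.log 2 = ent p X := by
  have h2 : Real.log 2 ≠ 0 := (Real.log_pos one_lt_two).ne'
  rw [ent, Finset.sum_neg_distrib, sum_mul_comp p X fun y => Real.log (law p X y), shannonEntropy,
    Finset.sum_neg_distrib, neg_mul, Finset.sum_mul]
  congr 1
  refine Finset.sum_congr rfl fun y _ => ?_
  rw [Real.logb]
  field_simp

/-- Conditioning reduces entropy: `H(V | Y) ≤ H(V | φ(Y))`. -/
lemma ent_submodular [Fintype Y] [Fintype W] (hp : ∀ ω, 0 ≤ p ω)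
    (X : Ω → Y) (φ : Y → Z) (V : Ω → W) :
    ent p (fun ω => (X ω, V ω)) + ent p (fun ω => φ (X ω)) ≤
      ent p X + ent p (fun ω => (φ (X ω), V ω)) := by
  set a := law p X
  set b := law p (fun ω => (φ (X ω), V ω))
  set c := law p (fun ω => (X ω, V ω))
  set d := law p (fun ω => φ (X ω))
  have ha : ∀ y, 0 ≤ a y := law_nonneg hp _
  have hb : ∀ y, 0 ≤ b y := law_nonneg hp _
  have hc : ∀ y, 0 ≤ c y := law_nonneg hp _
  have hd : ∀ y, 0 ≤ d y := law_nonneg hp _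
  let g : Y × W → ℝ := fun q => a q.1 * b (φ q.1, q.2) / (c q * d (φ q.1))
  -- pointwise `log g ≤ g - 1`, and the expectation of `g` is at most `1`
  have hpt : ∀ ω, p ω * (Real.log (a (X ω)) + Real.log (b (φ (X ω), V ω))
      - Real.log (c (X ω, V ω)) - Real.log (d (φ (X ω)))) ≤ p ω * g (X ω, V ω) - p ω := by
    intro ω
    by_cases h : p ω = 0
    · simp [h]
    have h1 : 0 < a (X ω) := law_pos hp _ h
    have h2 : 0 < b (φ (X ω), V ω) := law_pos hp (fun ω => (φ (X ω), V ω)) h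
    have h3 : 0 < c (X ω, V ω) := law_pos hp (fun ω => (X ω, V ω)) h
    have h4 : 0 < d (φ (X ω)) := law_pos hp (fun ω => φ (X ω)) h
    have := Real.log_le_sub_one_of_pos (x := g (X ω, V ω)) (by positivity)
    simp only [g] at this ⊢
    rw [Real.log_div (by positivity) (by positivity), Real.log_mul h1.ne' h2.ne',
      Real.log_mul h3.ne' h4.ne'] at this
    nlinarith [hp ω]
  have hsum : ∑ ω, p ω * g (X ω, V ω) ≤ ∑ ω, p ω := by
    rw [sum_mul_comp p (fun ω => (X ω, V ω)) g, Fintype.sum_prod_type, ← sum_law p X]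
    refine Finset.sum_le_sum fun y _ => ?_
    calc ∑ v, c (y, v) * g (y, v) ≤ ∑ v, a y / d (φ y) * b (φ y, v) := by
          refine Finset.sum_le_sum fun v _ => ?_
          have e : c (y, v) * g (y, v) = c (y, v) / c (y, v) * (a y / d (φ y) * b (φ y, v)) := by
            simp only [g, div_eq_mul_inv, mul_inv]; ring
          rw [e]
          exact mul_le_of_le_one_left
            (mul_nonneg (div_nonneg (ha _) (hd _)) (hb _)) (div_self_le_one _)
      _ = a y * (d (φ y) / d (φ y)) := by
          rw [← Finset.mul_sum, sum_law_prod p (fun ω => φ (X ω)) V]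
          simp only [d, div_eq_mul_inv]; ring
      _ ≤ a y := mul_le_of_le_one_right (ha _) (div_self_le_one _)
  have := Finset.sum_le_sum fun ω (_ : ω ∈ Finset.univ) => hpt ω
  rw [Finset.sum_sub_distrib] at this
  have e : ent p (fun ω => (X ω, V ω)) + ent p (fun ω => φ (X ω)) - ent p X
      - ent p (fun ω => (φ (X ω), V ω)) = ∑ ω, p ω * (Real.log (a (X ω))
        + Real.log (b (φ (X ω), V ω)) - Real.log (c (X ω, V ω)) - Real.log (d (φ (X ω)))) := by
    simp only [ent, ← Finset.sum_add_distrib, ← Finset.sum_sub_distrib]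
    refine Finset.sum_congr rfl fun ω _ => ?_
    simp only [a, b, c, d]; ring
  linarith

lemma ent_le_log_card [Fintype W] [Nonempty W] (hp : ∀ ω, 0 ≤ p ω) (hp1 : ∑ ω, p ω = 1)
    (V : Ω → W) : ent p V ≤ Real.log (Fintype.card W) := by
  have hM : (0 : ℝ) < Fintype.card W := by exact_mod_cast Fintype.card_pos
  have hpt : ∀ ω, -(p ω * Real.log (law p V (V ω))) ≤
      p ω * (1 / (Fintype.card W * law p V (V ω))) - p ω + p ω * Real.log (Fintype.card W) := by
    intro ω
    by_cases h : p ω = 0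
    · simp [h]
    have h1 := law_pos hp V h
    have := Real.log_le_sub_one_of_pos (x := 1 / (Fintype.card W * law p V (V ω))) (by positivity)
    rw [one_div, Real.log_inv, Real.log_mul hM.ne' h1.ne'] at this
    rw [one_div]
    nlinarith [hp ω]
  have hsum : ∑ ω, p ω * (1 / (Fintype.card W * law p V (V ω))) ≤ 1 := by
    rw [sum_mul_comp p V fun v => 1 / (Fintype.card W * law p V v)]
    calc _ ≤ ∑ _v : W, (1 : ℝ) / Fintype.card W := by
          refine Finset.sum_le_sum fun v _ => ?_
          have e : law p V v * (1 / (Fintype.card W * law p V v))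
              = law p V v / law p V v * (1 / Fintype.card W) := by
            simp only [div_eq_mul_inv, mul_inv]; ring
          rw [e]
          exact mul_le_of_le_one_left (by positivity) (div_self_le_one _)
      _ = 1 := by simp [hM.ne']
  have := Finset.sum_le_sum fun ω (_ : ω ∈ Finset.univ) => hpt ω
  rw [Finset.sum_add_distrib, Finset.sum_sub_distrib, ← Finset.sum_mul, hp1] at this
  rw [ent]
  linarith

/-- The mass function `p` conditioned on the event `V = v`. It is identically zero when this event
is null. -/
noncomputable def condOn (p : Ω → ℝ) (V : Ω → W) (v : W) : Ω → ℝ :=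
  fun ω => if V ω = v then p ω / law p V v else 0

lemma condOn_mem_stdSimplex (hp : ∀ ω, 0 ≤ p ω) (V : Ω → W) {v : W} (hv : law p V v ≠ 0) :
    condOn p V v ∈ stdSimplex ℝ Ω := by
  refine ⟨fun ω => ?_, ?_⟩
  · unfold condOn
    split_ifs
    exacts [div_nonneg (hp _) (law_nonneg hp _ _), le_rfl]
  · simp only [condOn]
    rw [← Finset.sum_filter, ← Finset.sum_div]
    exact div_self hv

/-- Chain rule: the entropies of the conditioned mass functions average to `H(X, V) - H(V)`. -/
lemma sum_law_mul_ent_condOn [Fintype W] (hp : ∀ ω, 0 ≤ p ω) (X : Ω → Y) (V : Ω → W) :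
    ∑ v, law p V v * ent (condOn p V v) X = ent p (fun ω => (X ω, V ω)) - ent p V := by
  have hlaw : ∀ v y, law (condOn p V v) X y = law p (fun ω => (X ω, V ω)) (y, v) / law p V v := by
    intro v y
    simp only [law, condOn, Prod.mk.injEq]
    rw [← Finset.sum_filter, Finset.filter_filter, Finset.sum_div]
  simp only [ent, Finset.mul_sum, hlaw]
  rw [Finset.sum_comm, ← Finset.sum_sub_distrib]
  refine Finset.sum_congr rfl fun ω _ => ?_
  rw [Finset.sum_eq_single (V ω)]
  · by_cases h : p ω = 0
    · simp [condOn, h]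
    have h1 := law_pos hp V h
    have h2 := law_pos hp (fun ω => (X ω, V ω)) h
    rw [Real.log_div h2.ne' h1.ne']
    simp only [condOn, if_true]
    field_simp
    ring
  · intro v _ hv
    simp [condOn, hv.symm]
  · simp

/-! ### Random hashing -/

lemma card_mul_sum_collision {S : Type*} [Fintype S] [DecidableEq S] [Fintype W] [AddGroup W]
    {x x' : S} (h : x ≠ x') :
    (Fintype.card W : ℝ) * ∑ f : S → W, (if f x' = f x then 1 else 0 : ℝ)
      = Fintype.card (S → W) := by
  -- translating `f` at the point `x` shows that each difference `f x' - f x` is equally frequent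
  have key : ∀ c : W, ∑ f : S → W, (if f x' = f x then 1 else 0 : ℝ)
      = ∑ f : S → W, (if f x' = f x + c then 1 else 0 : ℝ) := by
    intro c
    rw [← Equiv.sum_comp (Equiv.addRight (Pi.single x c : S → W))]
    refine Finset.sum_congr rfl fun f _ => ?_
    simp [Pi.single_eq_of_ne h.symm]
  calc _ = ∑ _c : W, ∑ f : S → W, (if f x' = f x then 1 else 0 : ℝ) := by simp
    _ = ∑ c : W, ∑ f : S → W, (if f x' = f x + c then 1 else 0 : ℝ) :=
        Finset.sum_congr rfl fun c _ => key c
    _ = ∑ f : S → W, ∑ c : W, (if -f x + f x' = c then 1 else 0 : ℝ) := by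
        rw [Finset.sum_comm]
        simp only [neg_add_eq_iff_eq_add]
    _ = _ := by simp

/-- Some hash `f` of `X` is nearly uniform given `Y`: its conditional entropy falls short of
`log |W|` by at most the expectation of `log (1 + |W| p / law p Y)`. Here `X` and `Y` together
determine the sample point, so `p / law p Y` is the conditional probability of `X` given `Y`. -/
lemma exists_hash {S : Type*} [Fintype S] [DecidableEq S] [Fintype W] [AddGroup W]
    (hp : ∀ ω, 0 ≤ p ω) (hp1 : ∑ ω, p ω = 1) (X : Ω → S) (U : Ω → Y)
    (hinj : ∀ ω ω', X ω = X ω' → U ω = U ω' → ω = ω') :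
    ∃ f : S → W, Real.log (Fintype.card W)
        - ∑ ω, p ω * Real.log (1 + Fintype.card W * (p ω / law p U (U ω)))
      ≤ ent p (fun ω => (U ω, f (X ω))) - ent p U := by
  classical
  set M : ℝ := (Fintype.card W : ℝ) with hMdef
  have hM : 0 < M := by rw [hMdef]; exact_mod_cast Fintype.card_pos
  set K : ℝ := (Fintype.card (S → W) : ℝ) with hKdef
  have hK : 0 < K := by rw [hKdef]; exact_mod_cast Fintype.card_pos
  have hcoll : ∀ ω ω', ∑ f : S → W, (if f (X ω') = f (X ω) then 1 else 0 : ℝ)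
      ≤ if X ω' = X ω then K else K / M := by
    intro ω ω'
    split_ifs with h
    · simp [h, hKdef]
    · rw [le_div_iff₀' hM, card_mul_sum_collision (Ne.symm h)]
  -- the expected probability of the cell containing `ω`
  have havg : ∀ ω, ∑ f : S → W, law p (fun ω => (U ω, f (X ω))) (U ω, f (X ω))
      ≤ K * (p ω + law p U (U ω) / M) := by
    intro ω
    have e : ∀ f : S → W, law p (fun ω => (U ω, f (X ω))) (U ω, f (X ω))
        = ∑ ω' with U ω' = U ω, p ω' * (if f (X ω') = f (X ω) then 1 else 0 : ℝ) := by
      intro f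
      simp only [law, Prod.mk.injEq, mul_ite, mul_one, mul_zero]
      rw [← Finset.sum_filter, Finset.filter_filter]
    simp only [e]
    rw [Finset.sum_comm]
    calc _ ≤ ∑ ω' with U ω' = U ω, ((if ω' = ω then K * p ω else 0) + K * (p ω' / M)) := by
          refine Finset.sum_le_sum fun ω' hω' => ?_
          rw [← Finset.mul_sum]
          refine (mul_le_mul_of_nonneg_left (hcoll ω ω') (hp ω')).trans ?_
          have h0 : 0 ≤ K * (p ω' / M) := mul_nonneg hK.le (div_nonneg (hp _) hM.le)
          by_cases h : X ω' = X ω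
          · obtain rfl := hinj _ _ h (Finset.mem_filter.1 hω').2
            simp only [if_true]
            linarith
          · rw [if_neg h]
            split_ifs with h'
            · exact absurd (congrArg X h') h
            · exact le_of_eq (by ring)
      _ = _ := by
          rw [Finset.sum_add_distrib, ← Finset.mul_sum, ← Finset.sum_div, law]
          simp only [Finset.sum_ite_eq', Finset.mem_filter, Finset.mem_univ, true_and, if_true]
          ring
  -- Jensen's inequality over the random `f`, with the tangent to `log` at the bound `a` just found
  have hpt : ∀ ω, ∑ f : S → W, p ω * (Real.log (law p (fun ω => (U ω, f (X ω))) (U ω, f (X ω)))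
      - Real.log (law p U (U ω)))
      ≤ K * (p ω * Real.log (1 + M * (p ω / law p U (U ω))) - p ω * Real.log M) := by
    intro ω
    by_cases h : p ω = 0
    · simp [h]
    have h0 : 0 < p ω := (hp ω).lt_of_ne' h
    have h1 := law_pos hp U h
    set t := law p U (U ω)
    set a := p ω + t / M
    have ha : 0 < a := by positivity
    have hlog : Real.log a = Real.log (1 + M * (p ω / t)) + Real.log t - Real.log M := by
      rw [← Real.log_mul (by positivity) h1.ne', ← Real.log_div (by positivity) hM.ne']
      congr 1
      simp only [a]
      field_simp
      ring
    rw [← Finset.mul_sum]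
    have : ∑ f : S → W, (Real.log (law p (fun ω => (U ω, f (X ω))) (U ω, f (X ω))) - Real.log t)
        ≤ K * (Real.log a - Real.log t) := by
      calc _ ≤ ∑ f : S → W, (law p (fun ω => (U ω, f (X ω))) (U ω, f (X ω)) / a - 1
              + (Real.log a - Real.log t)) := by
            refine Finset.sum_le_sum fun f _ => ?_
            have h2 := law_pos hp (fun ω => (U ω, f (X ω))) h
            have := Real.log_le_sub_one_of_pos (div_pos h2 ha)
            rw [Real.log_div h2.ne' ha.ne'] at this
            linarith
        _ = (∑ f : S → W, law p (fun ω => (U ω, f (X ω))) (U ω, f (X ω))) / a - K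
              + K * (Real.log a - Real.log t) := by
            rw [Finset.sum_add_distrib, Finset.sum_sub_distrib, ← Finset.sum_div]
            simp only [Finset.sum_const, Finset.card_univ, nsmul_eq_mul, mul_one, hKdef]
        _ ≤ _ := by
            have := (div_le_iff₀ ha).2 (havg ω)
            linarith
    rw [hlog] at this
    calc _ ≤ p ω * (K * (Real.log (1 + M * (p ω / t)) + Real.log t - Real.log M - Real.log t)) :=
          mul_le_mul_of_nonneg_left this h0.le
      _ = _ := by ring
  have hsum : ∑ f : S → W, (ent p U - ent p (fun ω => (U ω, f (X ω))))
      ≤ ∑ _f : S → W, (∑ ω, p ω * Real.log (1 + M * (p ω / law p U (U ω))) - Real.log M) := by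
    have := Finset.sum_le_sum fun ω (_ : ω ∈ Finset.univ) => hpt ω
    rw [Finset.sum_comm, ← Finset.mul_sum, Finset.sum_sub_distrib, ← Finset.sum_mul, hp1,
      one_mul] at this
    rw [Finset.sum_const, Finset.card_univ, nsmul_eq_mul]
    refine le_trans (le_of_eq ?_) this
    refine Finset.sum_congr rfl fun f _ => ?_
    rw [ent, ent, ← Finset.sum_sub_distrib]
    refine Finset.sum_congr rfl fun ω _ => ?_
    ring
  obtain ⟨f, -, hf⟩ := Finset.exists_le_of_sum_le Finset.univ_nonempty hsum
  exact ⟨f, by linarith⟩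

end FiniteSpace

/-! ### Exponential moments -/

lemma log_one_add_le_rpow_div {s t : ℝ} (hs : 0 < s) (hs1 : s ≤ 1) (ht : 0 ≤ t) :
    Real.log (1 + t) ≤ t ^ s / s := by
  have h1 : (1 + t) ^ s ≤ 1 + t ^ s := by
    simpa using Real.rpow_add_le_add_rpow zero_le_one ht hs.le hs1
  rw [le_div_iff₀' hs, ← Real.log_rpow (by linarith)]
  have := Real.log_le_sub_one_of_pos (x := (1 + t) ^ s) (Real.rpow_pos_of_pos (by linarith) _)
  linarith

/-- If `p`-almost surely `r > 0` and `log r` has expectation less than `-a`, then for a small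
exponent `s` the `s`-th moment of `r` is at most `exp (-s a)`. -/
lemma exists_moment_le {Ω : Type*} [Fintype Ω] {p r : Ω → ℝ} {a : ℝ}
    (hp1 : ∑ ω, p ω = 1) (hr : ∀ ω, p ω ≠ 0 → 0 < r ω)
    (ha : ∑ ω, p ω * Real.log (r ω) < -a) :
    ∃ s, 0 < s ∧ s ≤ 1 ∧ ∑ ω, p ω * r ω ^ s ≤ Real.exp (-(s * a)) := by
  -- the moment rescaled by `exp (s a)`: it equals `1` at `0` and has a negative derivative there
  let φ : ℝ → ℝ := fun s => ∑ ω, p ω * Real.exp (s * (Real.log (r ω) + a))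
  have hd : HasDerivAt φ (∑ ω, p ω * (Real.log (r ω) + a)) 0 := by
    refine HasDerivAt.fun_sum fun ω _ => ?_
    have := (((hasDerivAt_id (0 : ℝ)).mul_const (Real.log (r ω) + a)).exp).const_mul (p ω)
    simpa using this
  have hneg : ∑ ω, p ω * (Real.log (r ω) + a) < 0 := by
    simp only [mul_add, Finset.sum_add_distrib, ← Finset.sum_mul, hp1]
    linarith
  have hφ0 : φ 0 = 1 := by simp [φ, hp1]
  have hev : ∀ᶠ s in nhdsWithin (0 : ℝ) (Set.Ioi 0), φ s < φ 0 := by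
    have h := (hasDerivAt_iff_tendsto_slope.1 hd).eventually_lt_const hneg
    have h' := h.filter_mono (nhdsWithin_mono (0 : ℝ) (fun s (hs : 0 < s) => hs.ne'))
    filter_upwards [h', self_mem_nhdsWithin] with s hs hs0
    rw [slope_def_field, div_lt_iff₀ (by simpa using hs0)] at hs
    simpa using hs
  obtain ⟨s, hs, hs0, hs1⟩ := (hev.and (Ioc_mem_nhdsGT zero_lt_one)).exists
  refine ⟨s, hs0, hs1, ?_⟩
  have e : ∑ ω, p ω * r ω ^ s = Real.exp (-(s * a)) * φ s := by
    simp only [φ, Finset.mul_sum]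
    refine Finset.sum_congr rfl fun ω _ => ?_
    by_cases h : p ω = 0
    · simp [h]
    rw [Real.rpow_def_of_pos (hr ω h), mul_left_comm, ← Real.exp_add]
    ring_nf
  rw [e]
  exact mul_le_of_le_one_right (Real.exp_pos _).le (hφ0 ▸ hs.le)

section Family

variable {N : Type*} [Fintype N] [DecidableEq N]

/-! ### Entropy profiles of families of random variables -/

lemma basicIneq_dotProduct (i : N) {F : Finset N → ℝ} (hF : F ∅ = 0) :
    basicIneq i ⬝ᵥ (fun A => F A.1) = F Finset.univ - F (Finset.univ.erase i) := by
  have hne : Finset.univ.erase i ≠ (Finset.univ : Finset N) := by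
    simp [Finset.erase_eq_self]
  calc basicIneq i ⬝ᵥ (fun A => F A.1)
      = ∑ A : {A : Finset N // A.Nonempty},
          ((if A.1 = Finset.univ then F A.1 else 0)
            - if A.1 = Finset.univ.erase i then F A.1 else 0) := by
        refine Finset.sum_congr rfl fun A _ => ?_
        by_cases h : A.1 = Finset.univ
        · simp [basicIneq, h, hne.symm]
        · by_cases h' : A.1 = Finset.univ.erase i <;> simp [basicIneq, h, h', hne]
    _ = ∑ A : Finset N, ((if A = Finset.univ then F A else 0)
            - if A = Finset.univ.erase i then F A else 0) := by
        refine (Finset.sum_subtype (Finset.univ.filter fun A : Finset N => A.Nonempty) (by simp)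
          fun A : Finset N => (if A = Finset.univ then F A else 0)
            - if A = Finset.univ.erase i then F A else 0).symm.trans
          (Finset.sum_subset (Finset.filter_subset _ _) fun A _ hA => ?_)
        have : A = ∅ := by simpa using hA
        simp [this, hF]
    _ = _ := by
        rw [Finset.sum_sub_distrib, Finset.sum_ite_eq', Finset.sum_ite_eq']
        simp

lemma basicIneq_dotProduct_indicatorVec (i j : N) :
    basicIneq i ⬝ᵥ indicatorVec j = if i = j then 1 else 0 := by
  have := basicIneq_dotProduct i (F := fun A => if j ∈ A then 1 else 0) (by simp)
  refine this.trans ?_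
  by_cases h : i = j
  · simp [h]
  · simp [h, Ne.symm h]

variable {X : N → Type*} [∀ i, Fintype (X i)] [∀ i, DecidableEq (X i)]

lemma entropyProfile_mul_log_two (p : (∀ i, X i) → ℝ) (A : {A : Finset N // A.Nonempty}) :
    entropyProfile p A * Real.log 2 = ent p A.1.restrict :=
  shannonEntropy_law p A.1.restrict

lemma dotProduct_entropyProfile_mul_log_two (e : SetVec N) (p : (∀ i, X i) → ℝ) :
    (e ⬝ᵥ entropyProfile p) * Real.log 2 = ∑ A, e A * ent p A.1.restrict := by
  simp only [dotProduct, Finset.sum_mul, mul_assoc, entropyProfile_mul_log_two]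

lemma basicIneq_dotProduct_entropyProfile {p : (∀ i, X i) → ℝ} (hp1 : ∑ ω, p ω = 1) (i : N) :
    (basicIneq i ⬝ᵥ entropyProfile p) * Real.log 2
      = ent p (Finset.univ : Finset N).restrict - ent p (Finset.univ.erase i).restrict := by
  have h0 : ent p (∅ : Finset N).restrict = 0 := by
    rw [ent_eq_of_iff p (V := fun _ => ()) (by simp [funext_iff]), ent_const hp1]
  rw [dotProduct_entropyProfile_mul_log_two,
    ← basicIneq_dotProduct i (F := fun A => ent p A.restrict) h0]
  rfl

/-- The vector `r_i` is the entropy profile of a family in which the `i`-th variable is a fair bit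
and all the others are constant. -/
lemma indicatorVec_mem_entropyRegion (i : N) : indicatorVec i ∈ entropyRegion N := by
  let w : Bool → N → Bool := fun b => Function.update (fun _ => false) i b
  let p : (N → Bool) → ℝ := fun ω => ∑ b, if ω = w b then 1 / 2 else 0
  have hsum : ∀ g : (N → Bool) → ℝ, ∑ ω, p ω * g ω = ∑ b, 1 / 2 * g (w b) := by
    intro g
    simp only [p, Finset.sum_mul, ite_mul, zero_mul]
    rw [Finset.sum_comm]
    simp
  have hp : ∀ ω, 0 ≤ p ω := fun ω => Finset.sum_nonneg fun b _ => by positivity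
  have hp1 : ∑ ω, p ω = 1 := by simpa using hsum fun _ => 1
  refine ⟨fun _ => Bool, inferInstance, inferInstance, p, ⟨hp, hp1⟩, ?_⟩
  funext A
  have h2 : Real.log 2 ≠ 0 := (Real.log_pos one_lt_two).ne'
  refine mul_right_cancel₀ h2 ?_
  have hlaw : ∀ b, law p A.1.restrict (A.1.restrict (w b)) = if i ∈ A.1 then 1 / 2 else 1 := by
    intro b
    have e : law p A.1.restrict (A.1.restrict (w b))
        = ∑ ω, p ω * if A.1.restrict ω = A.1.restrict (w b) then 1 else 0 := by
      simp only [law, mul_ite, mul_one, mul_zero, Finset.sum_filter]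
    have hiff : ∀ b', A.1.restrict (w b') = A.1.restrict (w b) ↔ (i ∈ A.1 → b' = b) := by
      intro b'
      simp only [funext_iff, Finset.restrict, Subtype.forall, w]
      constructor
      · intro h hi
        simpa using h i hi
      · intro h j hj
        by_cases hji : j = i
        · subst hji
          simpa using h hj
        · simp [hji]
    rw [e, hsum]
    simp only [hiff]
    by_cases hi : i ∈ A.1 <;> cases b <;> simp [hi]
  refine Eq.trans ?_ (entropyProfile_mul_log_two p A).symm
  simp only [ent, Finset.sum_neg_distrib]
  rw [hsum fun ω => Real.log (law p A.1.restrict (A.1.restrict ω))]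
  simp only [hlaw, indicatorVec]
  by_cases hi : i ∈ A.1 <;> simp [hi]

/-- A valid inequality holds on average over the fibres of any `V`, hence for the conditional
entropies given `V`. -/
lemma sum_mul_condEnt_nonneg {X : N → Type} [∀ i, Fintype (X i)] [∀ i, DecidableEq (X i)]
    {W : Type*} [Fintype W] [DecidableEq W] {e : SetVec N} (he : e ∈ validIneqs N)
    {p : (∀ i, X i) → ℝ} (hp : ∀ ω, 0 ≤ p ω) (V : (∀ i, X i) → W) :
    0 ≤ ∑ A, e A * (ent p (fun ω => (A.1.restrict ω, V ω)) - ent p V) := by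
  have h2 : 0 < Real.log 2 := Real.log_pos one_lt_two
  have : ∑ A, e A * (ent p (fun ω => (A.1.restrict ω, V ω)) - ent p V)
      = ∑ v, law p V v * ((e ⬝ᵥ entropyProfile (condOn p V v)) * Real.log 2) := by
    simp only [dotProduct_entropyProfile_mul_log_two, ← sum_law_mul_ent_condOn hp, Finset.mul_sum]
    rw [Finset.sum_comm]
    simp only [mul_left_comm]
  rw [this]
  refine Finset.sum_nonneg fun v _ => ?_
  by_cases hv : law p V v = 0
  · simp [hv]
  · exact mul_nonneg (law_nonneg hp _ _) (mul_nonneg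
      (he _ ⟨X, inferInstance, inferInstance, _, condOn_mem_stdSimplex hp V hv, rfl⟩) h2.le)

/-! ### Independent copies -/

/-- The joint mass function of `n` independent copies of a family with mass function `p`; the
`i`-th variable of the new family is the `n`-tuple of the copies of the `i`-th variable. -/
noncomputable def iid (p : (∀ i, X i) → ℝ) (n : ℕ) : (∀ i, Fin n → X i) → ℝ :=
  fun x => ∏ k, p fun i => x i k

omit [∀ i, DecidableEq (X i)] in
lemma sum_prod_copies {n : ℕ} (G : Fin n → (∀ i, X i) → ℝ) :
    ∑ x : ∀ i, Fin n → X i, ∏ k, G k (fun i => x i k) = ∏ k, ∑ ω, G k ω := by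
  rw [Finset.prod_univ_sum, Fintype.piFinset_univ,
    ← Equiv.sum_comp (Equiv.piComm fun (i : N) (_ : Fin n) => X i)]
  rfl

omit [Fintype N] [DecidableEq N] [∀ i, Fintype (X i)] [∀ i, DecidableEq (X i)] in
lemma iid_nonneg {p : (∀ i, X i) → ℝ} (hp : ∀ ω, 0 ≤ p ω) (n : ℕ) (x : ∀ i, Fin n → X i) :
    0 ≤ iid p n x :=
  Finset.prod_nonneg fun _ _ => hp _

omit [∀ i, DecidableEq (X i)] in
lemma sum_iid {p : (∀ i, X i) → ℝ} (hp1 : ∑ ω, p ω = 1) (n : ℕ) : ∑ x, iid p n x = 1 := by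
  simp only [iid]
  rw [sum_prod_copies fun _ => p]
  simp [hp1]

lemma law_iid (p : (∀ i, X i) → ℝ) (n : ℕ) (A : Finset N) (x : ∀ i, Fin n → X i) :
    law (iid p n) A.restrict (A.restrict x)
      = ∏ k, law p A.restrict (A.restrict fun i => x i k) := by
  simp only [law, Finset.sum_filter]
  rw [← sum_prod_copies fun k ω => if A.restrict ω = A.restrict (fun i => x i k) then p ω else 0]
  refine Finset.sum_congr rfl fun y _ => ?_
  have hiff : A.restrict y = A.restrict x ↔
      ∀ k ∈ Finset.univ, A.restrict (fun i => y i k) = A.restrict fun i => x i k := by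
    simp only [funext_iff, Finset.restrict, Finset.mem_univ, true_imp_iff]
    exact forall_comm
  rw [Finset.prod_ite_zero]
  by_cases h : A.restrict y = A.restrict x
  · rw [if_pos h, if_pos (hiff.1 h), iid]
  · rw [if_neg h, if_neg (mt hiff.2 h)]

omit [∀ i, DecidableEq (X i)] in
lemma sum_iid_mul_sum {p : (∀ i, X i) → ℝ} (hp1 : ∑ ω, p ω = 1) (n : ℕ) (g : (∀ i, X i) → ℝ) :
    ∑ x, iid p n x * ∑ k, g (fun i => x i k) = n * ∑ ω, p ω * g ω := by
  have key : ∀ k : Fin n, ∑ x, iid p n x * g (fun i => x i k) = ∑ ω, p ω * g ω := by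
    intro k
    have e : ∀ x : ∀ i, Fin n → X i, iid p n x * g (fun i => x i k)
        = ∏ j, p (fun i => x i j) * (if j = k then g (fun i => x i j) else 1) := by
      intro x
      rw [Finset.prod_mul_distrib, Finset.prod_ite_eq' Finset.univ k]
      simp [iid]
    simp only [e]
    rw [sum_prod_copies fun j ω => p ω * (if j = k then g ω else 1),
      Finset.prod_eq_single k (fun j _ hj => by simp [hj, hp1]) (by simp)]
    simp
  simp only [Finset.mul_sum]
  rw [Finset.sum_comm]
  simp only [key, Finset.sum_const, Finset.card_univ, Fintype.card_fin, nsmul_eq_mul,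
    ← Finset.mul_sum]

lemma ent_iid {p : (∀ i, X i) → ℝ} (hp : ∀ ω, 0 ≤ p ω) (hp1 : ∑ ω, p ω = 1) (n : ℕ)
    (A : Finset N) : ent (iid p n) A.restrict = n * ent p A.restrict := by
  simp only [ent, Finset.sum_neg_distrib, mul_neg]
  rw [← sum_iid_mul_sum hp1 n fun ω => Real.log (law p A.restrict (A.restrict ω))]
  congr 1
  refine Finset.sum_congr rfl fun x _ => ?_
  by_cases h : iid p n x = 0
  · simp [h]
  rw [law_iid, Real.log_prod]
  intro k _
  exact (law_pos hp _ fun h0 => h (Finset.prod_eq_zero (Finset.mem_univ k) h0)).ne'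

/-! ### Subtracting a basic inequality -/

lemma ent_restrict_univ (p : (∀ i, X i) → ℝ) :
    ent p (Finset.univ : Finset N).restrict = -∑ ω, p ω * Real.log (p ω) := by
  rw [ent_eq_of_iff p (V := id) fun ω ω' => ?_]
  · simp [ent, law, Finset.sum_filter]
  · simp [funext_iff]

/-- If `a < H(N) - H(N \ i)`, then in `n` independent copies of the family some hash of the `i`-th
variable with `M ≤ exp (n a)` values has, conditionally on the other variables, an entropy within
a constant of its maximum `log M`. The constant does not depend on `n`. -/
lemma exists_hash_iid {p : (∀ i, X i) → ℝ} (hp : ∀ ω, 0 ≤ p ω) (hp1 : ∑ ω, p ω = 1) (i : N)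
    {a : ℝ} (ha : a < ent p (Finset.univ : Finset N).restrict
      - ent p (Finset.univ.erase i).restrict) :
    ∃ C, 0 ≤ C ∧ ∀ n M : ℕ, [NeZero M] → (M : ℝ) ≤ Real.exp (n * a) →
      ∃ f : (Fin n → X i) → Fin M, Real.log M - C
        ≤ ent (iid p n) (fun x => ((Finset.univ.erase i).restrict x, f (x i)))
          - ent (iid p n) (Finset.univ.erase i).restrict := by
  set U := (Finset.univ.erase i).restrict (π := X)
  set r : (∀ i, X i) → ℝ := fun ω => p ω / law p U (U ω) with hrdef
  have hr0 : ∀ ω, 0 ≤ r ω := fun ω => div_nonneg (hp ω) (law_nonneg hp _ _)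
  have hr : ∀ ω, p ω ≠ 0 → 0 < r ω := fun ω h => div_pos ((hp ω).lt_of_ne' h) (law_pos hp U h)
  have hlog : ∑ ω, p ω * Real.log (r ω) < -a := by
    rw [ent_restrict_univ, ent, Finset.sum_neg_distrib] at ha
    have : ∑ ω, p ω * Real.log (r ω)
        = ∑ ω, p ω * Real.log (p ω) - ∑ ω, p ω * Real.log (law p U (U ω)) := by
      rw [← Finset.sum_sub_distrib]
      refine Finset.sum_congr rfl fun ω _ => ?_
      by_cases h : p ω = 0
      · simp [h]
      rw [hrdef, Real.log_div h (law_pos hp U h).ne', mul_sub]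
    linarith
  obtain ⟨s, hs0, hs1, hs⟩ := exists_moment_le hp1 hr hlog
  refine ⟨1 / s, by positivity, fun n M _ hM => ?_⟩
  have hinj : ∀ x y : ∀ i, Fin n → X i, x i = y i →
      (Finset.univ.erase i).restrict x = (Finset.univ.erase i).restrict y → x = y := by
    intro x y hi h
    funext j
    by_cases hj : j = i
    · subst hj; exact hi
    · exact congrFun h ⟨j, by simp [hj]⟩
  obtain ⟨f, hf⟩ := exists_hash (W := Fin M) (iid_nonneg hp n) (sum_iid hp1 n)
    (fun x => x i) (Finset.univ.erase i).restrict hinj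
  refine ⟨f, le_trans ?_ hf⟩
  rw [Fintype.card_fin]
  refine sub_le_sub_left ?_ _
  have hrn : ∀ x : ∀ i, Fin n → X i, iid p n x / law (iid p n) (Finset.univ.erase i).restrict
      ((Finset.univ.erase i).restrict x) = ∏ k, r fun i => x i k := by
    intro x
    rw [law_iid, hrdef, Finset.prod_div_distrib]
    rfl
  simp only [hrn]
  have hM0 : (0 : ℝ) ≤ M := M.cast_nonneg
  calc _ ≤ ∑ x, iid p n x * ((M * ∏ k, r fun i => x i k) ^ s / s) :=
        Finset.sum_le_sum fun x _ => mul_le_mul_of_nonneg_left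
          (log_one_add_le_rpow_div hs0 hs1
            (mul_nonneg hM0 (Finset.prod_nonneg fun _ _ => hr0 _))) (iid_nonneg hp n x)
    _ = (M : ℝ) ^ s * (∑ ω, p ω * r ω ^ s) ^ n / s := by
        have e : (∑ ω, p ω * r ω ^ s) ^ n
            = ∑ x : ∀ i, Fin n → X i, ∏ k, (p (fun i => x i k) * r (fun i => x i k) ^ s) := by
          rw [sum_prod_copies fun _ ω => p ω * r ω ^ s]
          simp
        rw [e, Finset.mul_sum, Finset.sum_div]
        refine Finset.sum_congr rfl fun x _ => ?_
        rw [Real.mul_rpow hM0 (Finset.prod_nonneg fun _ _ => hr0 _),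
          ← Real.finsetProd_rpow _ _ fun _ _ => hr0 _, Finset.prod_mul_distrib, iid]
        ring
    _ ≤ Real.exp (n * a) ^ s * Real.exp (-(s * a)) ^ n / s := by
        have : 0 ≤ ∑ ω, p ω * r ω ^ s :=
          Finset.sum_nonneg fun ω _ => mul_nonneg (hp ω) (Real.rpow_nonneg (hr0 ω) s)
        gcongr
    _ = 1 / s := by
        rw [← Real.exp_mul, ← Real.exp_nat_mul, ← Real.exp_add]
        ring_nf
        simp

/-- A valid inequality remains valid when the multiple `e ⬝ᵥ r_i` of the basic
inequality `H(N) ≥ H(N \ i)` is subtracted: here `a` stands for any number below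
`H(N) - H(N \ i)`, and entropies are in nats. The proof applies `e` to `n` independent copies of
the family, conditioned on a hash of the `i`-th variable, and lets `n` grow. -/
lemma mul_le_sum_mul_ent {X : N → Type} [∀ i, Fintype (X i)] [∀ i, DecidableEq (X i)]
    {e : SetVec N} (he : e ∈ validIneqs N)
    {p : (∀ i, X i) → ℝ} (hp : ∀ ω, 0 ≤ p ω) (hp1 : ∑ ω, p ω = 1) (i : N)
    {a : ℝ} (ha0 : 0 ≤ a) (ha : a < ent p (Finset.univ : Finset N).restrict
      - ent p (Finset.univ.erase i).restrict) :
    (e ⬝ᵥ indicatorVec i) * a ≤ ∑ A, e A * ent p A.1.restrict := by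
  set c := e ⬝ᵥ indicatorVec i with hc
  have hc0 : 0 ≤ c := he _ (indicatorVec_mem_entropyRegion i)
  set E := ∑ A, e A * ent p A.1.restrict
  obtain ⟨C, hC0, hC⟩ := exists_hash_iid hp hp1 i ha
  -- a bound independent of `n` forces `c * a ≤ E`
  have key : ∀ n : ℕ, n * (c * a - E) ≤ c * (Real.log 2 + C) + (∑ A, |e A|) * C := by
    intro n
    set M := ⌊Real.exp (n * a)⌋₊
    -- rounding down to an integer costs at most a factor `2`
    have h1 : 1 ≤ Real.exp (n * a) := Real.one_le_exp (by positivity)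
    have hM1 : 1 ≤ M := Nat.one_le_floor_iff _ |>.2 h1
    have : NeZero M := ⟨by omega⟩
    have hM1' : (1 : ℝ) ≤ M := by exact_mod_cast hM1
    obtain ⟨f, hf⟩ := hC n M (Nat.floor_le (Real.exp_pos _).le)
    have hlogM : n * a ≤ Real.log 2 + Real.log M := by
      rw [← Real.log_mul two_ne_zero (by positivity), Real.le_log_iff_exp_le (by positivity)]
      have := Nat.lt_floor_add_one (Real.exp (n * a))
      linarith
    set P := iid p n
    have hP : ∀ x, 0 ≤ P x := iid_nonneg hp n
    have hP1 : ∑ x, P x = 1 := sum_iid hp1 n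
    let V : (∀ i, Fin n → X i) → Fin M := fun x => f (x i)
    have hVM : ent P V ≤ Real.log M := by simpa using ent_le_log_card hP hP1 V
    have hind : ∀ A : Finset N, ent P (fun x => (A.restrict x, V x)) ≤
        ent P A.restrict + ent P V := by
      intro A
      have := ent_submodular hP A.restrict (fun _ => ()) V
      rw [ent_const hP1, ent_eq_of_iff P (X := fun x => ((), V x)) (V := V) (by simp)] at this
      linarith
    have hV : Real.log M - C ≤ ent P V := by linarith [hind (Finset.univ.erase i)]
    have hA : ∀ A : {A : Finset N // A.Nonempty},
        e A * (ent P (fun x => (A.1.restrict x, V x)) - ent P V)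
          ≤ n * (e A * ent p A.1.restrict) - e A * indicatorVec i A * ent P V + |e A| * C := by
      intro A
      have hn : n * (e A * ent p A.1.restrict) = e A * ent P A.1.restrict := by
        rw [ent_iid hp hp1]; ring
      rw [hn]
      by_cases hi : i ∈ A.1
      · -- here `V` is a function of the marginal on `A`
        have : ent P (fun x => (A.1.restrict x, V x)) = ent P A.1.restrict := by
          refine ent_eq_of_iff P fun x y => ?_
          rw [Prod.mk.injEq]
          refine and_iff_left_of_imp fun h => congrArg f ?_
          exact congrFun h ⟨i, hi⟩
        rw [this]
        have : 0 ≤ |e A| * C := by positivity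
        simp only [indicatorVec, hi, if_true]
        linarith
      · -- here `V` is nearly independent of the marginal on `A`
        have hsub : A.1 ⊆ Finset.univ.erase i := fun j hj => by
          simp only [Finset.mem_erase, Finset.mem_univ, and_true]
          rintro rfl
          exact hi hj
        have hlow := ent_submodular hP (Finset.univ.erase i).restrict
          (Finset.restrict₂ (π := fun i => Fin n → X i) hsub) V
        have hlow' : ent P (fun x => ((Finset.univ.erase i).restrict x, V x))
            + ent P A.1.restrict ≤ ent P (Finset.univ.erase i).restrict
              + ent P (fun x => (A.1.restrict x, V x)) := hlow
        have habs : |ent P (fun x => (A.1.restrict x, V x)) - ent P V - ent P A.1.restrict|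
            ≤ C := by
          rw [abs_le]
          constructor
          · linarith
          · linarith [hind A.1]
        have := (le_abs_self _).trans_eq (abs_mul (e A)
          (ent P (fun x => (A.1.restrict x, V x)) - ent P V - ent P A.1.restrict))
        have := this.trans (mul_le_mul_of_nonneg_left habs (abs_nonneg _))
        simp only [indicatorVec, hi, if_false]
        linarith
    have hsum := (sum_mul_condEnt_nonneg he hP V).trans
      (Finset.sum_le_sum fun A _ => hA A)
    rw [Finset.sum_add_distrib, Finset.sum_sub_distrib, ← Finset.mul_sum, ← Finset.sum_mul,
      ← Finset.sum_mul] at hsum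
    change 0 ≤ n * E - c * ent P V + _ at hsum
    have := mul_le_mul_of_nonneg_left (show n * a - Real.log 2 - C ≤ ent P V by linarith) hc0
    linarith
  by_contra! hlt
  obtain ⟨n, hn⟩ := exists_nat_gt ((c * (Real.log 2 + C) + (∑ A, |e A|) * C) / (c * a - E))
  rw [div_lt_iff₀ (sub_pos.2 hlt)] at hn
  exact absurd (key n) hn.not_ge

lemma sub_smul_basicIneq_mem_validIneqs {e : SetVec N} (he : e ∈ validIneqs N) (i : N) :
    e - (e ⬝ᵥ indicatorVec i) • basicIneq i ∈ validIneqs N := by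
  rintro x hx
  have hx0 := he x hx
  obtain ⟨X, _, _, p, ⟨hp, hp1⟩, rfl⟩ := hx
  have hc0 : 0 ≤ e ⬝ᵥ indicatorVec i := he _ (indicatorVec_mem_entropyRegion i)
  have h2 : 0 < Real.log 2 := Real.log_pos one_lt_two
  rw [sub_dotProduct, smul_dotProduct, smul_eq_mul, sub_nonneg]
  set c := e ⬝ᵥ indicatorVec i
  refine le_of_mul_le_mul_right ?_ h2
  rw [mul_assoc, basicIneq_dotProduct_entropyProfile hp1]
  have hE := mul_nonneg hx0 h2.le
  set E := (e ⬝ᵥ entropyProfile p) * Real.log 2 with hEdef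
  by_contra! hlt
  have hc : 0 < c := hc0.lt_of_ne fun h => by rw [← h, zero_mul] at hlt; linarith
  rw [← div_lt_iff₀' hc] at hlt
  obtain ⟨a, ha1, ha2⟩ := exists_between hlt
  have := mul_le_sum_mul_ent he hp hp1 i ((div_nonneg hE hc.le).trans ha1.le) ha2
  rw [← dotProduct_entropyProfile_mul_log_two, ← hEdef] at this
  rw [div_lt_iff₀' hc] at ha1
  exact absurd this ha1.not_ge

lemma sub_sum_mem_validIneqs {e : SetVec N} (he : e ∈ validIneqs N) (S : Finset N) :
    e - ∑ i ∈ S, (e ⬝ᵥ indicatorVec i) • basicIneq i ∈ validIneqs N := by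
  induction S using Finset.induction_on with
  | empty => simpa using he
  | insert j S hj ih =>
    have h := sub_smul_basicIneq_mem_validIneqs ih j
    have e1 : (e - ∑ i ∈ S, (e ⬝ᵥ indicatorVec i) • basicIneq i) ⬝ᵥ indicatorVec j
        = e ⬝ᵥ indicatorVec j := by
      rw [sub_dotProduct, sum_dotProduct, Finset.sum_eq_zero, sub_zero]
      intro i hi
      rw [smul_dotProduct, basicIneq_dotProduct_indicatorVec, if_neg, smul_zero]
      rintro rfl
      exact hj hi
    rw [e1] at h
    rwa [Finset.sum_insert hj, add_comm, ← sub_sub]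

lemma sum_smul_basicIneq_dotProduct_indicatorVec (m : N → ℝ) (j : N) :
    (∑ i, m i • basicIneq i) ⬝ᵥ indicatorVec j = m j := by
  simp [sum_dotProduct, smul_dotProduct, basicIneq_dotProduct_indicatorVec]

end Family

end EntropyIneq

theorem mainTheorem9 {N : Type*} [Fintype N] [DecidableEq N]
    (e : EntropyIneq.SetVec N) (he : e ∈ EntropyIneq.validIneqs N) :
    ∃! d : (N → ℝ) × EntropyIneq.SetVec N,
      (∀ i, 0 ≤ d.1 i) ∧ d.2 ∈ EntropyIneq.validIneqs N ∧ EntropyIneq.IsBalanced d.2 ∧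
        e = (∑ i, d.1 i • EntropyIneq.basicIneq i) + d.2 := by
  refine ⟨(fun i => e ⬝ᵥ EntropyIneq.indicatorVec i,
    e - ∑ i, (e ⬝ᵥ EntropyIneq.indicatorVec i) • EntropyIneq.basicIneq i),
    ⟨fun i => he _ (EntropyIneq.indicatorVec_mem_entropyRegion i),
      EntropyIneq.sub_sum_mem_validIneqs he Finset.univ, fun j => ?_, ?_⟩, ?_⟩
  · rw [sub_dotProduct, EntropyIneq.sum_smul_basicIneq_dotProduct_indicatorVec, sub_self]
  · simp
  · rintro ⟨m, b⟩ ⟨-, -, hb, h⟩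
    simp only at hb h
    -- pairing with `r_j` annihilates the balanced part and isolates the `j`-th coefficient
    have hm : m = fun j => e ⬝ᵥ EntropyIneq.indicatorVec j := by
      funext j
      rw [h, add_dotProduct, hb j, add_zero,
        EntropyIneq.sum_smul_basicIneq_dotProduct_indicatorVec]
    subst hm
    exact Prod.ext rfl (eq_sub_of_add_eq' h.symm)
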